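/- Conventions. Maps are not assumed continuous unless said so. A metric space is proper if all its closed balls are compact. A map $f:X\to Y$ of metric spaces is coarse if preimages of bounded sets are bounded and for every $R>0$ there is $S>0$ such that $d(x,x')<R$ implies $d(f(x),f(x'))<S$. It is a coarse equivalence if it is coarse and there is a coarse map $g:Y\to X$ with $\sup_{x} d(gf(x),x)<\infty$ and $\sup_{y} d(fg(y),y)<\infty$. A metric space $X$ is uniformly contractible if for each $R>0$ there is $S>R$ such that for every $x\in X$ the inclusion $B(x,R)\hookrightarrow B(x,S)$ of open balls is null-homotopic. It has finite macroscopic dimension if it has an open cover by sets of uniformly bounded diameter and an integer $n$ such that every point lies in at most $n$ members of the cover. A closed subset $A$ of a space $W$ is a $\mathcal Z$-set if there is a homotopy $H:W\times[0,1]\to W$ with $H_0=\mathrm{id}_W$ and $H_t(W)\subseteq W-A$ for all $t>0$. A controlled $\mathcal Z$-compactification $\overline Y=Y\cup Z$ of a proper metric space $(Y,d)$ is a compact Hausdorff space $\overline Y$ containing $Y$ as a dense subspace such that the subspace $Z=\overline Y-Y$ is a $\mathcal Z$-set in $\overline Y$ and, for every $R>0$ and every open cover $\mathcal U$ of $\overline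 Y$, there is a compact set $C\subseteq Y$ such that every $A\subseteq Y-C$ with $\operatorname{diam}_d A<R$ is contained in some $U\in\mathcal U$. Theorem. Let $f:(X,d_X)\to(Y,d_Y)$ be a coarse equivalence between uniformly contractible proper metric spaces, each having finite macroscopic dimension, and suppose $Y$ admits a controlled $\mathcal Z$-compactification $\overline Y=Y\cup Z$. Then $X$ admits a controlled $\mathcal Z$-compactification $\overline X=X\cup Z$ with the same boundary $Z$ (that is, $\overline X-X$ is identified with $Z$ by a homeomorphism). If $f$ is continuous, this may be done so that $f$ extends to a continuous map $\overline f:\overline X\to\overline Y$ which is the identity on $Z$. -/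

import Mathlib

universe u v w w'

open scoped unitInterval

namespace BoundarySwapping

section Coarse

variable {X Y : Type*} [MetricSpace X] [MetricSpace Y]

/-- Preimages of bounded sets are bounded. -/
def MetricallyProper (f : X → Y) : Prop :=
  ∀ B : Set Y, Bornology.IsBounded B → Bornology.IsBounded (f ⁻¹' B)

/-- Large-scale uniform (bornologous) functions, not assumed continuous. -/
def LargeScaleUniform (f : X → Y) : Prop :=
  ∀ R : ℝ, 0 < R → ∃ S : ℝ, 0 < S ∧ ∀ x x' : X, dist x x' < R → dist (f x) (f x') < S

/-- Two functions whose pointwise distance is bounded. -/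
def BoundedlyClose (f g : X → Y) : Prop :=
  ∃ K : ℝ, ∀ x : X, dist (f x) (g x) ≤ K

/-- A coarse map: metrically proper and large-scale uniform. -/
def IsCoarse (f : X → Y) : Prop :=
  MetricallyProper f ∧ LargeScaleUniform f

/-- A coarse equivalence: a coarse map that has a coarse inverse. -/
def IsCoarseEquivalence (f : X → Y) : Prop :=
  IsCoarse f ∧ ∃ g : Y → X, IsCoarse g ∧ BoundedlyClose (g ∘ f) id ∧ BoundedlyClose (f ∘ g) id

end Coarse

/-- There is a uniformly bounded open cover and a number `n` such that every point lies in at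
most `n` members of the cover. -/
def FiniteMacroscopicDimension (X : Type*) [MetricSpace X] : Prop :=
  ∃ 𝒰 : Set (Set X),
    (∀ U ∈ 𝒰, IsOpen U) ∧ ⋃₀ 𝒰 = Set.univ ∧
    (∃ D : ℝ, ∀ U ∈ 𝒰, ∀ x ∈ U, ∀ y ∈ U, dist x y ≤ D) ∧
    ∃ n : ℕ, ∀ x : X, {U ∈ 𝒰 | x ∈ U}.encard ≤ n

/-- `A` contracts in `B`: `A ⊆ B` and the inclusion `A → B` is null-homotopic. -/
def ContractsIn {X : Type*} [TopologicalSpace X] (A B : Set X) : Prop :=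
  ∃ h : A ⊆ B, (ContinuousMap.inclusion h).Nullhomotopic

/-- For each `R > 0` there is `S > R` such that every ball of radius `R` contracts in the
concentric ball of radius `S`. -/
def UniformlyContractible (X : Type*) [MetricSpace X] : Prop :=
  ∀ R : ℝ, 0 < R → ∃ S : ℝ, R < S ∧
    ∀ x : X, ContractsIn (Metric.ball x R) (Metric.ball x S)

/-- A `𝒵`-set: a closed subset `A` of `W` from which `W` can be instantly homotoped off. -/
def IsZSet {W : Type*} [TopologicalSpace W] (A : Set W) : Prop :=
  IsClosed A ∧ ∃ H : C(W × I, W), (∀ w, H (w, 0) = w) ∧ ∀ w, ∀ t : I, 0 < t → H (w, t) ∉ A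

/-- `W`, together with the maps `i : Y → W` and `j : Z → W`, is a `𝒵`-compactification `Y ∪ Z`
of `Y` with boundary `Z`: `W` is compact Hausdorff, `i` embeds `Y` as a dense subset, and `j` is
a homeomorphism of `Z` onto the complement of `Y`, which is a `𝒵`-set in `W`. -/
structure IsZCompactification {Y Z W : Type*} [TopologicalSpace Y] [TopologicalSpace Z]
    [TopologicalSpace W] (i : Y → W) (j : Z → W) : Prop where
  compact : CompactSpace W
  hausdorff : T2Space W
  isEmbedding : Topology.IsEmbedding i
  denseRange : DenseRange i
  isEmbedding_boundary : Topology.IsEmbedding j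
  range_boundary : Set.range j = (Set.range i)ᶜ
  isZSet : IsZSet (Set.range j)

/-- A controlled `𝒵`-compactification of a metric space `Y`: for every `R > 0` and every open
cover of `W` there is a compact `C ⊆ Y` such that each subset of `Y - C` of diameter less than `R`
lies in a member of the cover. (Boundedness is explicit since `Metric.diam` of an unbounded set
is `0` by convention.) -/
structure IsControlledZCompactification {Y Z W : Type*} [MetricSpace Y] [TopologicalSpace Z]
    [TopologicalSpace W] (i : Y → W) (j : Z → W) : Prop extends IsZCompactification i j where
  control : ∀ R : ℝ, 0 < R → ∀ 𝒰 : Set (Set W), (∀ U ∈ 𝒰, IsOpen U) → ⋃₀ 𝒰 = Set.univ →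
    ∃ C : Set Y, IsCompact C ∧
      ∀ A : Set Y, A ⊆ Cᶜ → Bornology.IsBounded A → Metric.diam A < R →
        ∃ U ∈ 𝒰, i '' A ⊆ U

end BoundarySwapping

namespace BoundarySwapping

/-! ### Extending maps into uniformly contractible spaces -/

open Topology Filter Set

/-! Finite macroscopic dimension of the source and uniform contractibility of the target make coarse
data continuous at bounded cost: over finitely many open sets, each split into small separated
pieces, a partially defined map is extended by contracting balls, one set at a time, and finitely
many steps keep the error bounded (`exists_continuous_extension`). Hence `f` and its coarse inverse
may be taken to be continuous maps `f` and `g`, and `g ∘ f` is boundedly homotopic to the identity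
of `X` by some `K`.

Topologize `X ∪ Z` inside `Ybar × OnePoint X` by the extension of `f` and the collapse of `Z`;
properness of `f` makes the image closed, hence compact Hausdorff. Control in `Ybar` says that
bounded displacements vanish at the boundary. So control passes to `X ∪ Z`, and `g` extends by the
identity of `Z` to a map `G`.

If `H` pushes `Ybar` off `Z`, then `G ∘ H_t ∘ f` (with `f` extended by the identity of `Z`) pushes
`X ∪ Z` off `Z`, but it starts at `g ∘ f` on `X`. Running `K` first, for a time that shrinks to zero
at `Z`, corrects the start; this remains continuous at `Z` because `K` is bounded (`isZSet_bdry`).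
-/

/-- Uniform contractibility, with the contractions of balls given by total functions. -/
theorem UniformlyContractible.exists_contraction {Y : Type*} [MetricSpace Y]
    (hY : UniformlyContractible Y) {R : ℝ} (hR : 0 < R) :
    ∃ S : ℝ, R < S ∧ ∃ (C : Y → Y → I → Y) (p : Y → Y), ∀ y,
      ContinuousOn (fun q : Y × I => C y q.1 q.2) (Metric.ball y R ×ˢ univ) ∧
      (∀ a ∈ Metric.ball y R, C y a 0 = a) ∧ (∀ a ∈ Metric.ball y R, C y a 1 = p y) ∧
      (∀ a ∈ Metric.ball y R, ∀ t, dist (C y a t) y < S) ∧ dist (p y) y < S := by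
  classical
  obtain ⟨S, hRS, hS⟩ := hY R hR
  refine ⟨S, hRS, ?_⟩
  have key : ∀ y, ∃ (C : Y → I → Y) (p : Y),
      ContinuousOn (fun q : Y × I => C q.1 q.2) (Metric.ball y R ×ˢ univ) ∧
      (∀ a ∈ Metric.ball y R, C a 0 = a) ∧ (∀ a ∈ Metric.ball y R, C a 1 = p) ∧
      (∀ a ∈ Metric.ball y R, ∀ t, dist (C a t) y < S) ∧ dist p y < S := by
    intro y
    obtain ⟨hsub, p, ⟨F⟩⟩ := hS y
    refine ⟨fun a t => if h : a ∈ Metric.ball y R then (F (t, ⟨a, h⟩) : Y) else y, p,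
      ?_, ?_, ?_, ?_, p.2⟩
    · rw [continuousOn_iff_continuous_domRestrict]
      have hc : Continuous fun q : ↥(Metric.ball y R ×ˢ (univ : Set I)) =>
          (F (q.1.2, ⟨q.1.1, q.2.1⟩) : Y) := by fun_prop
      refine hc.congr fun q => ?_
      have hq : q.1.1 ∈ Metric.ball y R := q.2.1
      simp only [domRestrict_apply]
      rw [dif_pos hq]
    · intro a ha
      simp only [dif_pos ha, F.apply_zero]
      rfl
    · intro a ha
      simp only [dif_pos ha, F.apply_one]
      rfl
    · intro a ha t
      simp only [dif_pos ha]
      exact (F (t, ⟨a, ha⟩)).2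
  choose C p h using key
  exact ⟨C, p, h⟩

/-- A map defined near a closed set `A` extends, after shrinking its domain around `A`, over an
open set `W` carrying a locally constant function `c` that is boundedly close to `F`. -/
theorem exists_extension_step {P Y : Type*} [TopologicalSpace P] [NormalSpace P] [MetricSpace Y]
    (hY : UniformlyContractible Y) (F : P → Y) {D D₁ : ℝ} {W : Set P} (hW : IsOpen W) (c : P → Y)
    (hc : ∀ x ∈ W, ∀ᶠ x' in 𝓝 x, c x' = c x) (hcF : ∀ x ∈ W, dist (F x) (c x) ≤ D₁)
    {A U : Set P} (hA : IsClosed A) (hU : IsOpen U) (hAU : A ⊆ U) {h : P → Y}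
    (hh : ContinuousOn h U) (hhF : ∀ x ∈ U, dist (h x) (F x) ≤ D) :
    ∃ (D' : ℝ) (U' : Set P) (h' : P → Y), IsOpen U' ∧ A ∪ W ⊆ U' ∧ ContinuousOn h' U' ∧
      EqOn h' h A ∧ ∀ x ∈ U', dist (h' x) (F x) ≤ D' := by
  classical
  -- `h x` is within `D` of `F x`, which is within `D₁` of `c x`; the absolute values and the `1`
  -- make the radius positive and the ball membership strict.
  obtain ⟨S, -, C, p, hC⟩ := hY.exists_contraction (R := |D| + |D₁| + 1) (by positivity)
  choose hCc hC0 hC1 hCS hpS using hC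
  obtain ⟨V, hVo, hAV, hVU⟩ := normal_exists_closure_subset hA hU hAU
  obtain ⟨V₂, hV₂o, hVV₂, hV₂U⟩ := normal_exists_closure_subset isClosed_closure hU hVU
  obtain ⟨u, hu0, hu1, huI⟩ := exists_continuous_zero_one_of_isClosed
    (isClosed_closure (s := V)) hV₂o.isClosed_compl (disjoint_compl_right_iff_subset.2 hVV₂)
  let v : P → I := fun x => ⟨u x, huI x⟩
  have hv : Continuous v := by fun_prop
  have hv0 : ∀ x ∈ V, v x = 0 := fun x hx => Subtype.ext (hu0 (subset_closure hx))
  have hv1 : ∀ x ∉ V₂, v x = 1 := fun x hx => Subtype.ext (hu1 hx)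
  have hball : ∀ x ∈ U, x ∈ W → h x ∈ Metric.ball (c x) (|D| + |D₁| + 1) := by
    intro x hxU hxW
    have h1 := dist_triangle (h x) (F x) (c x)
    have h2 := hhF x hxU
    have h3 := hcF x hxW
    have h4 := le_abs_self D
    have h5 := le_abs_self D₁
    rw [Metric.mem_ball]
    linarith
  -- Over `W`, `h x` slides along the contraction of the ball about `c x`: not at all near `A`, and
  -- all the way to `p (c x)` before `x` leaves `U`, where `h` is no longer controlled. As `c` is
  -- locally constant, only one contraction is involved near each point.
  let h' : P → Y := fun x =>
    if x ∈ W then (if x ∈ U then C (c x) (h x) (v x) else p (c x)) else h x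
  have hVh : ∀ x ∈ V, h' x = h x := by
    intro x hx
    have hxU := hVU (subset_closure hx)
    by_cases hxW : x ∈ W
    · simp only [h', if_pos hxW, if_pos hxU, hv0 x hx]
      exact hC0 _ _ (hball x hxU hxW)
    · simp only [h', if_neg hxW]
  refine ⟨max D (S + D₁), V ∪ W, h', hVo.union hW, union_subset_union_left _ hAV, ?_,
    fun x hx => hVh x (hAV hx), ?_⟩
  · intro x hx
    apply ContinuousAt.continuousWithinAt
    by_cases hxV : x ∈ V
    · have hxU := hVU (subset_closure hxV)
      refine (hh.continuousAt (hU.mem_nhds hxU)).congr ?_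
      filter_upwards [hVo.mem_nhds hxV] with x' hx' using (hVh x' hx').symm
    · have hxW : x ∈ W := hx.resolve_left hxV
      by_cases hxU : x ∈ U
      · have hcont : ContinuousAt (fun x' => C (c x) (h x') (v x')) x := by
          have h1 : ContinuousAt (fun q : Y × I => C (c x) q.1 q.2) (h x, v x) :=
            (hCc (c x)).continuousAt
              ((Metric.isOpen_ball.prod isOpen_univ).mem_nhds ⟨hball x hxU hxW, mem_univ _⟩)
          exact ContinuousAt.comp (f := fun x' => (h x', v x')) h1
            ((hh.continuousAt (hU.mem_nhds hxU)).prodMk hv.continuousAt)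
        refine hcont.congr ?_
        filter_upwards [hU.mem_nhds hxU, hW.mem_nhds hxW, hc x hxW] with x' h1 h2 h3
        simp only [h', if_pos h1, if_pos h2, h3]
      · have hxV₂ : x ∉ closure V₂ := fun hx' => hxU (hV₂U hx')
        refine (continuousAt_const (y := p (c x))).congr ?_
        filter_upwards [isClosed_closure.isOpen_compl.mem_nhds hxV₂, hW.mem_nhds hxW, hc x hxW]
          with x' h1 h2 h3
        by_cases h4 : x' ∈ U
        · simp only [h', if_pos h4, if_pos h2, hv1 x' (fun hx' => h1 (subset_closure hx'))]
          rw [hC1 _ _ (hball x' h4 h2), h3]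
        · simp only [h', if_neg h4, if_pos h2, h3]
  · intro x hx
    by_cases hxW : x ∈ W
    · have hFc : dist (c x) (F x) ≤ D₁ := by rw [dist_comm]; exact hcF x hxW
      have hlt : dist (h' x) (c x) < S := by
        by_cases hxU : x ∈ U
        · simp only [h', if_pos hxW, if_pos hxU]
          exact hCS _ _ (hball x hxU hxW) _
        · simp only [h', if_pos hxW, if_neg hxU]
          exact hpS _
      exact le_max_of_le_right ((dist_triangle _ (c x) _).trans (by linarith))
    · have hxV : x ∈ V := hx.resolve_right hxW
      rw [hVh x hxV]
      exact le_max_of_le_left (hhF x (hVU (subset_closure hxV)))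

/-- Extension of a map defined near a closed set to a globally defined continuous map boundedly
close to a function `F` which is controlled by finitely many locally constant functions. -/
theorem exists_continuous_extension {P Y ι : Type*} [TopologicalSpace P] [NormalSpace P]
    [MetricSpace Y] [Finite ι] (hY : UniformlyContractible Y) (F : P → Y) {D D₁ : ℝ}
    {W : ι → Set P} (hW : ∀ i, IsOpen (W i)) (hWc : ⋃ i, W i = univ) (c : ι → P → Y)
    (hc : ∀ i, ∀ x ∈ W i, ∀ᶠ x' in 𝓝 x, c i x' = c i x)
    (hcF : ∀ i, ∀ x ∈ W i, dist (F x) (c i x) ≤ D₁)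
    {A U : Set P} (hA : IsClosed A) (hU : IsOpen U) (hAU : A ⊆ U) {h : P → Y}
    (hh : ContinuousOn h U) (hhF : ∀ x ∈ U, dist (h x) (F x) ≤ D) :
    ∃ h' : P → Y, Continuous h' ∧ EqOn h' h A ∧ BoundedlyClose h' F := by
  classical
  cases nonempty_fintype ι
  -- Each step preserves values only on a closed set and shrinks the domain around it, so the
  -- induction tracks closed sets `B i ⊆ W i` that still cover.
  obtain ⟨B, hBc, hBcl, hBW⟩ := exists_iUnion_eq_closed_subset hW (fun x => toFinite _) hWc
  have key : ∀ s : Finset ι, ∃ (D' : ℝ) (U' : Set P) (h' : P → Y), IsOpen U' ∧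
      (A ∪ ⋃ i ∈ s, B i) ⊆ U' ∧ ContinuousOn h' U' ∧ EqOn h' h A ∧
      ∀ x ∈ U', dist (h' x) (F x) ≤ D' := by
    intro s
    induction s using Finset.induction_on with
    | empty => exact ⟨D, U, h, hU, by simpa using hAU, hh, fun _ _ => rfl, hhF⟩
    | insert i s _ ih =>
      obtain ⟨D', U', h', hU', hAU', hh', heq, hF'⟩ := ih
      have hcl : IsClosed (A ∪ ⋃ i ∈ s, B i) :=
        hA.union (s.finite_toSet.isClosed_biUnion fun i _ => hBcl i)
      obtain ⟨D'', U'', h'', hU'', hAU'', hh'', heq', hF''⟩ :=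
        exists_extension_step hY F (hW i) (c i) (hc i) (hcF i) hcl hU' hAU' hh' hF'
      refine ⟨D'', U'', h'', hU'', ?_, hh'', ?_, hF''⟩
      · rw [Finset.set_biUnion_insert]
        rintro x (hx | hx | hx)
        · exact hAU'' (Or.inl (Or.inl hx))
        · exact hAU'' (Or.inr (hBW i hx))
        · exact hAU'' (Or.inl (Or.inr hx))
      · exact fun x hx => (heq' (Or.inl hx)).trans (heq hx)
  obtain ⟨D', U', h', -, hsub, hcont, heq, hF⟩ := key Finset.univ
  have hU' : U' = univ := by
    refine eq_univ_of_univ_subset (subset_trans ?_ hsub)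
    rw [← hBc]
    simp
  rw [hU'] at hcont hF
  exact ⟨h', continuousOn_univ.1 hcont, heq, D', fun x => hF x (mem_univ x)⟩

/-! ### Colouring a cover of finite multiplicity -/

/-- Finite macroscopic dimension as a cover by finitely many open sets, each of which is a
disjoint union of uniformly bounded open sets; `r` picks a point near each of these. -/
theorem FiniteMacroscopicDimension.exists_locally_constant {X : Type*} [MetricSpace X]
    (hX : FiniteMacroscopicDimension X) :
    ∃ (n : ℕ) (D : ℝ) (W : Fin n → Set X) (r : Fin n → X → X), (∀ i, IsOpen (W i)) ∧
      ⋃ i, W i = univ ∧ (∀ i, ∀ x ∈ W i, ∀ᶠ x' in 𝓝 x, r i x' = r i x) ∧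
      ∀ i, ∀ x ∈ W i, dist x (r i x) ≤ D := by
  classical
  obtain ⟨𝒰, hopen, hcov, ⟨D, hD⟩, n, hn⟩ := hX
  obtain ⟨p, hp⟩ := PartitionOfUnity.exists_isSubordinate isClosed_univ
    (fun U : 𝒰 => (U : Set X)) (fun U => hopen U U.2) (by rw [← sUnion_eq_iUnion, hcov])
  have hpU : ∀ (i : 𝒰) x, p i x ≠ 0 → x ∈ (i : Set X) := fun i x hx =>
    hp i (subset_tsupport _ hx)
  have hfin : ∀ x, {i : 𝒰 | p i x ≠ 0}.Finite := fun x => p.locallyFinite.point_finite x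
  have hcard : ∀ x, (hfin x).toFinset.card ≤ n := by
    intro x
    have h1 : (Subtype.val '' {i : 𝒰 | p i x ≠ 0}).encard ≤ n := by
      refine (encard_le_encard ?_).trans (hn x)
      rintro _ ⟨i, hi, rfl⟩
      exact ⟨i.2, hpU i x hi⟩
    rw [Subtype.val_injective.encard_image, (hfin x).encard_eq_coe_toFinset_card] at h1
    exact_mod_cast h1
  -- As in barycentric subdivision, `V u` is where the functions indexed by `u` dominate all others.
  -- Distinct `u` of equal cardinality give disjoint sets, so cardinality serves as the colour; for
  -- nonempty `u`, `V u` is bounded because it lies in a member of the cover.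
  let V : Finset 𝒰 → Set X := fun u =>
    {x | (∀ i ∈ u, 0 < p i x) ∧ ∀ i ∈ u, ∀ j ∉ u, p j x < p i x}
  have hVo : ∀ u, IsOpen (V u) := by
    intro u
    rw [isOpen_iff_mem_nhds]
    rintro x ⟨hx1, hx2⟩
    have hpos : ∀ᶠ x' in 𝓝 x, ∀ i ∈ u, 0 < p i x' :=
      (Finset.eventually_all u).2 fun i hi =>
        (p i).continuous.continuousAt.eventually_const_lt (hx1 i hi)
    -- Local finiteness leaves finitely many `j` to compare; the other functions vanish near `x`.
    obtain ⟨T, hT, hTfin⟩ := p.locallyFinite x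
    have hlt : ∀ᶠ x' in 𝓝 x, ∀ i ∈ u, ∀ j ∈ hTfin.toFinset, j ∉ u → p j x' < p i x' := by
      refine (Finset.eventually_all u).2 fun i hi => (Finset.eventually_all _).2 fun j _ => ?_
      by_cases hj : j ∈ u
      · exact Eventually.of_forall fun x' h => absurd hj h
      · filter_upwards [(p j).continuous.continuousAt.eventually_lt
          (p i).continuous.continuousAt (hx2 i hi j hj)] with x' h _ using h
    filter_upwards [hpos, hlt, hT] with x' h1 h2 h3
    refine ⟨h1, fun i hi j hj => ?_⟩
    by_cases hjT : j ∈ hTfin.toFinset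
    · exact h2 i hi j hjT hj
    · have : p j x' = 0 := by
        by_contra hne
        exact hjT (hTfin.mem_toFinset.2 ⟨x', hne, h3⟩)
      rw [this]
      exact h1 i hi
  have huniq : ∀ u v x, x ∈ V u → x ∈ V v → u.card = v.card → u = v := by
    intro u v x hu hv hc
    by_contra hne
    obtain ⟨i, hi, hi'⟩ := Finset.not_subset.1 fun h => hne (Finset.eq_of_subset_of_card_le h hc.ge)
    obtain ⟨j, hj, hj'⟩ := Finset.not_subset.1
      fun h => hne (Finset.eq_of_subset_of_card_le h hc.le).symm
    exact lt_asymm (hu.2 i hi j hj') (hv.2 j hj i hi')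
  let s : Fin (n + 1) → X → Finset 𝒰 := fun k x =>
    if h : ∃ u : Finset 𝒰, u.Nonempty ∧ u.card = k ∧ x ∈ V u then h.choose else ∅
  have hs : ∀ (k : Fin (n + 1)) (u : Finset 𝒰) x, u.Nonempty → u.card = k → x ∈ V u →
      s k x = u := by
    intro k u x hne hc hx
    have h : ∃ u : Finset 𝒰, u.Nonempty ∧ u.card = k ∧ x ∈ V u := ⟨u, hne, hc, hx⟩
    simp only [s, dif_pos h]
    exact huniq _ _ x h.choose_spec.2.2 hx (h.choose_spec.2.1.trans hc.symm)
  let q : X → Finset 𝒰 → X := fun x u =>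
    if h : ∃ i ∈ u, (i : Set X).Nonempty then h.choose_spec.2.choose else x
  rcases isEmpty_or_nonempty X with hXe | ⟨⟨x₀⟩⟩
  · exact ⟨0, 0, fun _ => ∅, fun _ x => x, fun _ => isOpen_empty,
      Subsingleton.elim _ _, fun _ x => (hXe.false x).elim, fun _ x => (hXe.false x).elim⟩
  refine ⟨n + 1, D, fun k => {x | ∃ u : Finset 𝒰, u.Nonempty ∧ u.card = k ∧ x ∈ V u},
    -- The fallback is the fixed `x₀`, so the chosen point depends on `x` only through `s k x`.
    fun k x => q x₀ (s k x), ?_, ?_, ?_, ?_⟩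
  · intro k
    rw [isOpen_iff_mem_nhds]
    rintro x ⟨u, hne, hc, hx⟩
    filter_upwards [(hVo u).mem_nhds hx] with x' hx' using ⟨u, hne, hc, hx'⟩
  · refine eq_univ_of_forall fun x => mem_iUnion.2
      ⟨⟨(hfin x).toFinset.card, Nat.lt_succ_of_le (hcard x)⟩, (hfin x).toFinset, ?_, rfl, ?_, ?_⟩
    · obtain ⟨i, hi⟩ := p.exists_pos (mem_univ x)
      exact ⟨i, (hfin x).mem_toFinset.2 hi.ne'⟩
    · intro i hi
      exact lt_of_le_of_ne (p.nonneg i x) (Ne.symm ((hfin x).mem_toFinset.1 hi))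
    · intro i hi j hj
      have hj0 : p j x = 0 := by
        by_contra hne
        exact hj ((hfin x).mem_toFinset.2 hne)
      rw [hj0]
      exact lt_of_le_of_ne (p.nonneg i x) (Ne.symm ((hfin x).mem_toFinset.1 hi))
  · rintro k x ⟨u, hne, hc, hx⟩
    filter_upwards [(hVo u).mem_nhds hx] with x' hx'
    rw [hs k u x hne hc hx, hs k u x' hne hc hx']
  · rintro k x ⟨u, hne, hc, hx⟩
    simp only [hs k u x hne hc hx]
    obtain ⟨i, hi⟩ := hne
    have hxi : ∀ j ∈ u, x ∈ (j : Set X) := fun j hj => hpU j x (hx.1 j hj).ne'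
    have h : ∃ i ∈ u, (i : Set X).Nonempty := ⟨i, hi, x, hxi i hi⟩
    simp only [q, dif_pos h]
    exact hD _ h.choose.2 x (hxi _ h.choose_spec.1) _ h.choose_spec.2.choose_spec

theorem LargeScaleUniform.exists_dist_le {X Y : Type*} [MetricSpace X] [MetricSpace Y] {f : X → Y}
    (hf : LargeScaleUniform f) (R : ℝ) :
    ∃ S : ℝ, ∀ x x', dist x x' ≤ R → dist (f x) (f x') ≤ S := by
  obtain ⟨S, -, hS⟩ := hf (|R| + 1) (by positivity)
  exact ⟨S, fun x x' h => (hS x x' (by linarith [le_abs_self R])).le⟩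

/-! ### Continuous approximations and bounded homotopies -/

/-- Large-scale uniform functions can be approximated by continuous maps. -/
theorem LargeScaleUniform.exists_continuous {X Y : Type*} [MetricSpace X] [MetricSpace Y]
    (hX : FiniteMacroscopicDimension X) (hY : UniformlyContractible Y) {f : X → Y}
    (hf : LargeScaleUniform f) : ∃ f' : X → Y, Continuous f' ∧ BoundedlyClose f' f := by
  obtain ⟨n, D, W, r, hWo, hWc, hr, hrD⟩ := hX.exists_locally_constant
  obtain ⟨S, hS⟩ := hf.exists_dist_le D
  -- Nothing is prescribed: `A` and `U` are empty, so `h` and `D` are placeholders.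
  obtain ⟨f', hf', -, hc⟩ := exists_continuous_extension (D := 0) (D₁ := S) hY f hWo hWc
    (fun i x => f (r i x)) (fun i x hx => (hr i x hx).mono fun x' h => by rw [h])
    (fun i x hx => hS _ _ (hrD i x hx)) isClosed_empty isOpen_empty (empty_subset _)
    (h := f) (continuousOn_empty f) (by simp)
  exact ⟨f', hf', hc⟩

/-- A continuous self-map boundedly close to the identity is boundedly homotopic to it. -/
theorem BoundedlyClose.exists_homotopy {X : Type*} [MetricSpace X]
    (hX : FiniteMacroscopicDimension X) (hX' : UniformlyContractible X) {k : X → X}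
    (hk : Continuous k) (hkid : BoundedlyClose k id) :
    ∃ K : X × I → X, Continuous K ∧ (∀ x, K (x, 0) = x) ∧ (∀ x, K (x, 1) = k x) ∧
      BoundedlyClose K Prod.fst := by
  classical
  obtain ⟨n, D, W, r, hWo, hWc, hr, hrD⟩ := hX.exists_locally_constant
  obtain ⟨E, hE⟩ := hkid
  -- The extension lemma needs data on a neighbourhood of the two ends, hence the two open halves;
  -- the jump at `1 / 2` lies outside their union.
  let h : X × I → X := fun q => if (q.2 : ℝ) < 1 / 2 then q.1 else k q.1
  have hlt : IsOpen {q : X × I | (q.2 : ℝ) < 1 / 2} := isOpen_lt (by fun_prop) (by fun_prop)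
  have hgt : IsOpen {q : X × I | 1 / 2 < (q.2 : ℝ)} := isOpen_lt (by fun_prop) (by fun_prop)
  have hA : IsClosed {q : X × I | q.2 = 0 ∨ q.2 = 1} :=
    (isClosed_eq continuous_snd continuous_const).union
      (isClosed_eq continuous_snd continuous_const)
  obtain ⟨K, hK, hKA, hKc⟩ := exists_continuous_extension (D := |E|) (D₁ := D) hX'
    (Prod.fst : X × I → X) (W := fun i => Prod.fst ⁻¹' W i)
    (fun i => (hWo i).preimage continuous_fst)
    (by rw [← preimage_iUnion, hWc, preimage_univ]) (fun i q => r i q.1)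
    (fun i q hq => continuousAt_fst.eventually (hr i q.1 hq)) (fun i q hq => hrD i q.1 hq)
    hA (hlt.union hgt) (h := h) (by
      rintro q (hq | hq)
      · exact Or.inl (show (q.2 : ℝ) < 1 / 2 by rw [hq]; norm_num)
      · exact Or.inr (show 1 / 2 < (q.2 : ℝ) by rw [hq]; norm_num)) (by
      rintro q (hq | hq)
      · refine ContinuousAt.continuousWithinAt (continuousAt_fst.congr ?_)
        filter_upwards [hlt.mem_nhds hq] with q' hq'
        exact (if_pos hq').symm
      · refine ContinuousAt.continuousWithinAt
          ((hk.comp continuous_fst).continuousAt.congr ?_)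
        filter_upwards [hgt.mem_nhds hq] with q' hq'
        exact (if_neg (not_lt.2 (le_of_lt hq'))).symm) (by
      intro q _
      by_cases hq : (q.2 : ℝ) < 1 / 2
      · simp only [h, if_pos hq, dist_self]
        positivity
      · simp only [h, if_neg hq]
        exact (hE q.1).trans (le_abs_self E))
  refine ⟨K, hK, fun x => ?_, fun x => ?_, hKc⟩
  · rw [hKA (Or.inl rfl)]
    simp [h]
  · rw [hKA (Or.inr rfl)]
    simp only [h]
    rw [if_neg (by norm_num)]

/-! ### Control as a local condition at the boundary -/

section ZCompactification

variable {Y Z W : Type*} {i : Y → W} {j : Z → W}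

theorem IsZCompactification.isOpen_range [TopologicalSpace Y] [TopologicalSpace Z]
    [TopologicalSpace W] (h : IsZCompactification i j) : IsOpen (range i) := by
  rw [← compl_compl (range i), ← h.range_boundary]
  exact h.isZSet.1.isOpen_compl

theorem IsZCompactification.isOpenEmbedding [TopologicalSpace Y] [TopologicalSpace Z]
    [TopologicalSpace W] (h : IsZCompactification i j) : IsOpenEmbedding i :=
  ⟨h.isEmbedding, h.isOpen_range⟩

theorem IsZCompactification.ne [TopologicalSpace Y] [TopologicalSpace Z]
    [TopologicalSpace W] (h : IsZCompactification i j) (y : Y) (z : Z) : i y ≠ j z := fun he => by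
  have : j z ∈ (range i)ᶜ := h.range_boundary ▸ mem_range_self z
  exact this ⟨y, he⟩

theorem IsZCompactification.exists_eq [TopologicalSpace Y] [TopologicalSpace Z]
    [TopologicalSpace W] (h : IsZCompactification i j) (x : W) :
    (∃ y, i y = x) ∨ ∃ z, j z = x := by
  by_cases hx : x ∈ range i
  · exact Or.inl hx
  · exact Or.inr (show x ∈ range j from h.range_boundary ▸ hx)

theorem IsZCompactification.compl_image_mem_nhds [TopologicalSpace Y] [TopologicalSpace Z]
    [TopologicalSpace W] (h : IsZCompactification i j) {K : Set Y} (hK : IsCompact K) (z : Z) :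
    (i '' K)ᶜ ∈ 𝓝 (j z) := by
  have := h.hausdorff
  refine (hK.image h.isEmbedding.continuous).isClosed.isOpen_compl.mem_nhds ?_
  rintro ⟨y, -, hy⟩
  exact h.ne y z hy

/-- Near the boundary of a controlled compactification, points at bounded distance converge to the
same boundary point. -/
theorem IsControlledZCompactification.eventually_near [MetricSpace Y] [ProperSpace Y]
    [TopologicalSpace Z] [TopologicalSpace W] (h : IsControlledZCompactification i j) (R : ℝ)
    (z : Z) {N : Set W} (hN : N ∈ 𝓝 (j z)) :
    ∀ᶠ x in 𝓝 (j z), ∀ y, i y = x → ∀ y', dist y y' ≤ R → i y' ∈ N := by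
  have := h.hausdorff
  have := h.compact
  obtain ⟨N₀, hN₀, hN₀o, hzN₀⟩ := mem_nhds_iff.1 hN
  obtain ⟨M, hM, hMc, hMN⟩ := exists_mem_nhds_isClosed_subset (hN₀o.mem_nhds hzN₀)
  -- In this two-member cover, a pair meeting `M` and lying in one member must lie in `N₀`.
  -- Thickening `C` below keeps the partner `y'` off `C` as well.
  obtain ⟨C, hC, hCU⟩ := h.control (|R| + 1) (by positivity) {N₀, Mᶜ}
    (by rintro U (rfl | rfl); exacts [hN₀o, hMc.isOpen_compl])
    (by
      rw [sUnion_pair, eq_univ_iff_forall]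
      exact fun x => (em (x ∈ M)).imp (fun hx => hMN hx) id)
  filter_upwards [hM, h.compl_image_mem_nhds (hC.cthickening (r := |R|)) z]
  rintro _ hyM hyC y rfl y' hyy'
  have hy : y ∉ Metric.cthickening |R| C := fun hy => hyC ⟨y, hy, rfl⟩
  obtain ⟨U, hU, hsub⟩ := hCU {y, y'} (by
    rintro a (rfl | rfl) ha
    · exact hy (Metric.self_subset_cthickening C ha)
    · exact hy (Metric.mem_cthickening_of_dist_le y a _ C ha (hyy'.trans (le_abs_self R))))
    (by simp) (by rw [Metric.diam_pair]; linarith [le_abs_self R])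
  rcases hU with rfl | rfl
  · exact hN₀ (hsub ⟨y', by simp, rfl⟩)
  · exact absurd hyM (hsub ⟨y, by simp, rfl⟩)

/-- Every boundary point has a neighbourhood whose points carry their `R`-neighbours into one member
of the cover. What these neighbourhoods miss is closed in `W` and contained in `Y`, hence a compact
set that can serve as `C`. -/
theorem IsZCompactification.isControlled [MetricSpace Y] [Nonempty Y]
    [TopologicalSpace Z] [TopologicalSpace W] (h : IsZCompactification i j)
    (hnear : ∀ (R : ℝ) (z : Z), ∀ N ∈ 𝓝 (j z),
      ∀ᶠ x in 𝓝 (j z), ∀ y, i y = x → ∀ y', dist y y' ≤ R → i y' ∈ N) :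
    IsControlledZCompactification i j := by
  refine ⟨h, fun R hR 𝒰 hopen hcov => ?_⟩
  have := h.compact
  have hz : ∀ z, ∃ U ∈ 𝒰, j z ∈ U := fun z => by
    have : j z ∈ ⋃₀ 𝒰 := hcov ▸ mem_univ _
    exact this
  choose U hU hzU using hz
  have hV : ∀ z, ∃ V : Set W, (∀ x ∈ V, ∀ y, i y = x → ∀ y', dist y y' ≤ R → i y' ∈ U z) ∧
      IsOpen V ∧ j z ∈ V := fun z =>
    mem_nhds_iff.1 (hnear R z (U z) ((hopen _ (hU z)).mem_nhds (hzU z)))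
  choose V hV hVo hzV using hV
  have hK : IsClosed (⋃ z, V z)ᶜ := (isOpen_iUnion hVo).isClosed_compl
  have hKi : (⋃ z, V z)ᶜ ⊆ range i := fun x hx => by
    obtain h' | ⟨z, rfl⟩ := h.exists_eq x
    · exact h'
    · exact absurd (mem_iUnion.2 ⟨z, hzV z⟩) hx
  refine ⟨i ⁻¹' (⋃ z, V z)ᶜ, h.isEmbedding.isInducing.isCompact_preimage' hK.isCompact hKi,
    fun A hA hAb hAR => ?_⟩
  rcases A.eq_empty_or_nonempty with rfl | ⟨y, hy⟩
  -- The empty set still needs some member of the cover, which a point of `Y` provides.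
  · obtain ⟨y⟩ := ‹Nonempty Y›
    have : i y ∈ ⋃₀ 𝒰 := hcov ▸ mem_univ _
    obtain ⟨U, hU, -⟩ := this
    exact ⟨U, hU, by simp⟩
  · have hyV : i y ∈ ⋃ z, V z := not_not.1 (hA hy)
    obtain ⟨z, hz⟩ := mem_iUnion.1 hyV
    refine ⟨U z, hU z, ?_⟩
    rintro _ ⟨y', hy', rfl⟩
    exact hV z _ hz y rfl y' ((Metric.dist_le_diam_of_mem hAb hy hy').trans hAR.le)

end ZCompactification

/-! ### The space X ∪ Z -/

/-- The union of `X` and the boundary `Z` of a compactification `Ybar = Y ∪ Z`, topologized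
through `f : X → Y`. -/
inductive SwappedSpace {X : Type u} {Y : Type v} {Z : Type w} {Ybar : Type w'}
    (f : X → Y) (i : Y → Ybar) (j : Z → Ybar) : Type (max u w)
  | inner (x : X) : SwappedSpace f i j
  | bdry (z : Z) : SwappedSpace f i j

namespace SwappedSpace

variable {X : Type u} {Y : Type v} {Z : Type w} {Ybar : Type w'} {f : X → Y} {i : Y → Ybar}
  {j : Z → Ybar}

/-- The extension of `f` by the identity of `Z`. -/
def map : SwappedSpace f i j → Ybar
  | inner x => i (f x)
  | bdry z => j z

/-- The collapse of the boundary to the point at infinity. -/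
def collapse : SwappedSpace f i j → OnePoint X
  | inner x => (x : OnePoint X)
  | bdry _ => OnePoint.infty

/-- The first coordinate decides convergence to points of `Z`; the second restores the topology of
`X`, which a non-injective `f` would lose. -/
instance [TopologicalSpace X] [TopologicalSpace Ybar] : TopologicalSpace (SwappedSpace f i j) :=
  .induced (fun p => (map p, collapse p)) inferInstance

theorem isInducing [TopologicalSpace X] [TopologicalSpace Ybar] :
    IsInducing (fun p : SwappedSpace f i j => (map p, collapse p)) := ⟨rfl⟩

theorem continuous_map [TopologicalSpace X] [TopologicalSpace Ybar] :
    Continuous (map : SwappedSpace f i j → Ybar) :=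
  continuous_fst.comp isInducing.continuous

theorem continuous_collapse [TopologicalSpace X] [TopologicalSpace Ybar] :
    Continuous (collapse : SwappedSpace f i j → OnePoint X) :=
  continuous_snd.comp isInducing.continuous

theorem range_inner_eq : range (inner : X → SwappedSpace f i j) = collapse ⁻¹' {OnePoint.infty}ᶜ := by
  ext (x | z)
  · simp [collapse]
  · simp [collapse]

theorem range_bdry_eq : range (bdry : Z → SwappedSpace f i j) = (range inner)ᶜ := by
  ext (x | z) <;> simp

variable [MetricSpace X] [TopologicalSpace Ybar]

theorem isEmbedding_bdry [TopologicalSpace Z] (hj : IsEmbedding j) :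
    IsEmbedding (bdry : Z → SwappedSpace f i j) :=
  .of_comp (isInducing.continuous_iff.2 (hj.continuous.prodMk continuous_const))
    continuous_map hj

theorem compl_image_mem_nhds_bdry {K : Set X} (hK : IsCompact K) (z : Z) :
    {p | ∀ x, p = inner x → x ∉ K} ∈ 𝓝 (bdry z : SwappedSpace f i j) := by
  have h : (((↑) : X → OnePoint X) '' K)ᶜ ∈ 𝓝 (collapse (bdry z : SwappedSpace f i j)) :=
    (OnePoint.isOpen_compl_image_coe.2 ⟨hK.isClosed, hK⟩).mem_nhds (by simp [collapse])
  filter_upwards [continuous_collapse.continuousAt.eventually_mem h]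
  rintro _ hp x rfl hx
  exact hp ⟨x, hx, rfl⟩

theorem exists_of_mem_nhds_bdry {z : Z} {N : Set (SwappedSpace f i j)} (hN : N ∈ 𝓝 (bdry z)) :
    ∃ N₁ ∈ 𝓝 (j z), ∃ K : Set X, IsCompact K ∧ (∀ x, i (f x) ∈ N₁ → x ∉ K → inner x ∈ N) ∧
      ∀ z', j z' ∈ N₁ → bdry z' ∈ N := by
  rw [isInducing.nhds_eq_comap, mem_comap] at hN
  obtain ⟨M, hM, hMN⟩ := hN
  obtain ⟨N₁, hN₁, N₂, hN₂, hsub⟩ := mem_nhds_prod_iff.1 hM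
  have hN₂' : ((↑) : X → OnePoint X) ⁻¹' N₂ ∈ cocompact X := by
    rw [← coclosedCompact_eq_cocompact]
    exact (OnePoint.tendsto_coe_infty (X := X)).eventually_mem hN₂
  obtain ⟨K, hK, hKN⟩ := mem_cocompact.1 hN₂'
  exact ⟨N₁, hN₁, K, hK, fun x hx hxK => hMN (hsub ⟨hx, hKN hxK⟩),
    fun z' hz' => hMN (hsub ⟨hz', mem_of_mem_nhds hN₂⟩)⟩

variable [MetricSpace Y]

theorem isOpenEmbedding_inner (hf : Continuous f) (hi : Continuous i) :
    IsOpenEmbedding (inner : X → SwappedSpace f i j) := by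
  have hc : Continuous (inner : X → SwappedSpace f i j) :=
    isInducing.continuous_iff.2 ((hi.comp hf).prodMk OnePoint.continuous_coe)
  refine ⟨⟨.of_comp hc continuous_collapse OnePoint.isOpenEmbedding_coe.isInducing,
    fun a b h => by injection h⟩, ?_⟩
  rw [range_inner_eq]
  exact isClosed_singleton.isOpen_compl.preimage continuous_collapse

variable [ProperSpace X]

theorem isCompact_closure_preimage [ProperSpace Y] (hf : MetricallyProper f) {K : Set Y}
    (hK : IsCompact K) : IsCompact (closure (f ⁻¹' K)) :=
  (hf K hK.isBounded).isCompact_closure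

/-- A function vanishing exactly on the boundary. -/
theorem exists_continuous_pos [Nonempty X] (hf : Continuous f) (hi : Continuous i) :
    ∃ l : SwappedSpace f i j → ℝ, Continuous l ∧ (∀ x, 0 < l (inner x)) ∧
      ∀ z, l (bdry z) = 0 := by
  obtain ⟨x₀⟩ := ‹Nonempty X›
  let l : SwappedSpace f i j → ℝ := fun p => match p with
    | inner x => (1 + dist x x₀)⁻¹
    | bdry _ => 0
  refine ⟨l, continuous_iff_continuousAt.2 ?_, fun x => by positivity, fun _ => rfl⟩
  rintro (x | z)
  · rw [← (isOpenEmbedding_inner hf hi).continuousAt_iff]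
    have h : Continuous fun x => (1 + dist x x₀)⁻¹ :=
      Continuous.inv₀ (by fun_prop) fun x => by positivity
    exact h.continuousAt
  · change Tendsto l _ (𝓝 (0 : ℝ))
    rw [tendsto_order]
    refine ⟨fun a ha => Eventually.of_forall ?_, fun a ha => ?_⟩
    · rintro (x | z)
      · exact ha.trans (by positivity)
      · exact ha
    · filter_upwards [compl_image_mem_nhds_bdry (isCompact_closedBall x₀ a⁻¹) z]
      rintro (x | z) hx
      · have h1 := hx x rfl
        rw [Metric.mem_closedBall, not_le] at h1
        exact inv_lt_of_inv_lt₀ ha (by linarith)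
      · exact ha

variable [ProperSpace Y] [TopologicalSpace Z]

/-- The range is the graph of `f` together with `Z × {∞}`. Off the graph, separate `a` from `f x`. A
point `(y, ∞)` with `y` in `Y` is not a limit because the preimage under `f` of a compact
neighbourhood of `y` has compact closure. -/
theorem isClosed_range_map_collapse (hY : IsZCompactification i j) (hf : Continuous f)
    (hfp : MetricallyProper f) :
    IsClosed (range fun p : SwappedSpace f i j => (map p, collapse p)) := by
  have := hY.hausdorff
  rw [← isOpen_compl_iff, isOpen_iff_mem_nhds]
  rintro ⟨a, b⟩ hab
  induction b using OnePoint.rec with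
  | coe x =>
    have hne : a ≠ i (f x) := fun h => hab ⟨inner x, by rw [h]; rfl⟩
    obtain ⟨A, B, hA, hB, haA, hB', hAB⟩ := t2_separation hne
    have hO : IsOpen (((↑) : X → OnePoint X) '' (f ⁻¹' (i ⁻¹' B))) :=
      OnePoint.isOpenEmbedding_coe.isOpenMap _ ((hB.preimage hY.isEmbedding.continuous).preimage hf)
    filter_upwards [prod_mem_nhds (hA.mem_nhds haA) (hO.mem_nhds ⟨x, hB', rfl⟩)]
    rintro _ ⟨h1, x', h2, h3⟩ ⟨p | p, rfl⟩
    · have h3 : (x' : OnePoint X) = (p : OnePoint X) := h3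
      rw [OnePoint.coe_eq_coe] at h3
      subst h3
      exact disjoint_left.1 hAB h1 h2
    · exact OnePoint.coe_ne_infty _ h3
  | infty =>
    obtain ⟨y, rfl⟩ | ⟨z, rfl⟩ := hY.exists_eq a
    · obtain ⟨B, hB, hyB⟩ := exists_compact_mem_nhds y
      have hK := isCompact_closure_preimage hfp hB
      have hO : IsOpen (((↑) : X → OnePoint X) '' (closure (f ⁻¹' B)))ᶜ :=
        OnePoint.isOpen_compl_image_coe.2 ⟨isClosed_closure, hK⟩
      have hiB : i '' B ∈ 𝓝 (i y) := hY.isOpenEmbedding.isOpenMap.image_mem_nhds hyB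
      filter_upwards [prod_mem_nhds hiB (hO.mem_nhds (by simp))]
      rintro _ ⟨⟨y', h1, h2⟩, h3⟩ ⟨p | p, rfl⟩
      · have h2 : y' = f p := hY.isEmbedding.injective h2
        exact h3 ⟨p, subset_closure (by rwa [mem_preimage, ← h2]), rfl⟩
      · exact hY.ne _ _ h2
    · exact absurd ⟨bdry z, rfl⟩ hab

theorem isClosedEmbedding (hY : IsZCompactification i j) (hf : Continuous f)
    (hfp : MetricallyProper f) :
    IsClosedEmbedding (fun p : SwappedSpace f i j => (map p, collapse p)) := by
  refine ⟨⟨isInducing, ?_⟩, isClosed_range_map_collapse hY hf hfp⟩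
  rintro (x | z) (x' | z') h
  · rw [OnePoint.coe_eq_coe.1 (congrArg Prod.snd h)]
  · exact absurd (congrArg Prod.snd h) (OnePoint.coe_ne_infty x)
  · exact absurd (congrArg Prod.snd h) (OnePoint.infty_ne_coe x')
  · rw [hY.isEmbedding_boundary.injective (congrArg Prod.fst h)]

theorem eventually_near (hY : IsControlledZCompactification i j) (hf : LargeScaleUniform f)
    (R : ℝ) (z : Z) {N : Set (SwappedSpace f i j)} (hN : N ∈ 𝓝 (bdry z)) :
    ∀ᶠ p in 𝓝 (bdry z : SwappedSpace f i j), ∀ x, inner x = p → ∀ x', dist x x' ≤ R →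
      inner x' ∈ N := by
  obtain ⟨S, hS⟩ := hf.exists_dist_le R
  obtain ⟨N₁, hN₁, K, hK, hKN, -⟩ := exists_of_mem_nhds_bdry hN
  filter_upwards [continuous_map.continuousAt.eventually (hY.eventually_near S z hN₁),
    compl_image_mem_nhds_bdry (hK.cthickening (r := R)) z]
  rintro _ h1 h2 x rfl x' hx'
  exact hKN x' (h1 (f x) rfl (f x') (hS x x' hx')) fun hK' =>
    h2 x rfl (Metric.mem_cthickening_of_dist_le x x' _ K hK' hx')

/-- A continuous coarse inverse of `f` extends by the identity of `Z`. -/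
theorem exists_extension_inverse (hY : IsControlledZCompactification i j) (hf : Continuous f)
    {g : Y → X} (hg : Continuous g) (hgp : MetricallyProper g)
    (hfg : BoundedlyClose (f ∘ g) id) :
    ∃ G : Ybar → SwappedSpace f i j, Continuous G ∧ (∀ y, G (i y) = inner (g y)) ∧
      ∀ z, G (j z) = bdry z := by
  classical
  have hex : ∀ a : Ybar, ∃ p : SwappedSpace f i j,
      (∀ y, i y = a → p = inner (g y)) ∧ ∀ z, j z = a → p = bdry z := by
    intro a
    obtain ⟨y, rfl⟩ | ⟨z, rfl⟩ := hY.exists_eq a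
    · exact ⟨inner (g y), fun y' h => by rw [hY.isEmbedding.injective h],
        fun z h => absurd h.symm (hY.ne y z)⟩
    · exact ⟨bdry z, fun y h => absurd h (hY.ne y z),
        fun z' h => by rw [hY.isEmbedding_boundary.injective h]⟩
  choose G hGi hGj using hex
  refine ⟨G, continuous_iff_continuousAt.2 fun a => ?_, fun y => hGi _ y rfl, fun z => hGj _ z rfl⟩
  obtain ⟨y, rfl⟩ | ⟨z, rfl⟩ := hY.exists_eq a
  · rw [← hY.isOpenEmbedding.continuousAt_iff]
    have h : G ∘ i = inner ∘ g := funext fun y => hGi _ y rfl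
    rw [h]
    exact ((isOpenEmbedding_inner hf hY.isEmbedding.continuous).continuous.comp hg).continuousAt
  · obtain ⟨E, hE⟩ := hfg
    rw [ContinuousAt, hGj _ z rfl, tendsto_def]
    intro N hN
    obtain ⟨N₁, hN₁, K, hK, hKN, hN'⟩ := exists_of_mem_nhds_bdry hN
    -- `f (g y)` is within `E` of `y`, so it approaches the same boundary point, while properness of
    -- `g` keeps `g y` outside `K`.
    filter_upwards [hN₁, hY.eventually_near E z hN₁,
      hY.compl_image_mem_nhds (isCompact_closure_preimage hgp hK) z] with a ha h1 h2
    rw [mem_preimage]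
    obtain ⟨y, rfl⟩ | ⟨z, rfl⟩ := hY.exists_eq a
    · rw [hGi _ y rfl]
      refine hKN _ (h1 y rfl _ ?_) fun hK' => h2 ⟨y, subset_closure hK', rfl⟩
      rw [dist_comm]
      exact hE y
    · rw [hGj _ z rfl]
      exact hN' z ha

/-- Two homotopies are concatenated at a speed depending on the point: `K` on the time interval `[0,
l]`, then `G ∘ H ∘ map` with its clock started at `l`. They agree at time `l`, where both give `g (f
x)`; since `l` vanishes on `Z`, boundary points follow only the second. -/
theorem isZSet_bdry [Nonempty X] (hY : IsControlledZCompactification i j) (hf : Continuous f)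
    (hfu : LargeScaleUniform f) {g : Y → X} {G : Ybar → SwappedSpace f i j} (hG : Continuous G)
    (hGi : ∀ y, G (i y) = inner (g y)) (hGj : ∀ z, G (j z) = bdry z)
    {K : X × I → X} (hK : Continuous K) (hK0 : ∀ x, K (x, 0) = x) (hK1 : ∀ x, K (x, 1) = g (f x))
    (hKc : BoundedlyClose K Prod.fst) : IsZSet (range (bdry : Z → SwappedSpace f i j)) := by
  have hemb : IsOpenEmbedding (inner : X → SwappedSpace f i j) :=
    isOpenEmbedding_inner hf hY.isEmbedding.continuous
  refine ⟨?_, ?_⟩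
  · rw [range_bdry_eq]
    exact hemb.isOpen_range.isClosed_compl
  obtain ⟨-, H, hH0, hH⟩ := hY.isZSet
  obtain ⟨l, hl, hlx, hlz⟩ :=
    exists_continuous_pos (f := f) (i := i) (j := j) hf hY.isEmbedding.continuous
  obtain ⟨E, hE⟩ := hKc
  let Q : SwappedSpace f i j × I → SwappedSpace f i j := fun q =>
    G (H (map q.1, projIcc 0 1 zero_le_one ((q.2 : ℝ) - l q.1)))
  have hQ : Continuous Q := by
    refine hG.comp (H.continuous.comp ((continuous_map.comp continuous_fst).prodMk ?_))
    exact continuous_projIcc.comp (by fun_prop)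
  let T : X → I → X := fun x t => K (x, projIcc 0 1 zero_le_one ((t : ℝ) / l (inner x)))
  have hT : Continuous fun q : X × I => T q.1 q.2 := by
    refine hK.comp (continuous_fst.prodMk (continuous_projIcc.comp ?_))
    exact Continuous.div (by fun_prop) (hl.comp (hemb.continuous.comp continuous_fst))
      fun q => (hlx q.1).ne'
  let F : SwappedSpace f i j × I → SwappedSpace f i j := fun q => match q.1 with
    | inner x => if (q.2 : ℝ) ≤ l (inner x) then inner (T x q.2) else Q (inner x, q.2)
    | bdry z => Q (bdry z, q.2)
  have hFor : ∀ q : SwappedSpace f i j × I,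
      ((q.2 : ℝ) ≤ l q.1 ∧ ∃ x, inner x = q.1 ∧ F q = inner (T x q.2)) ∨ F q = Q q := by
    rintro ⟨x | z, t⟩
    · by_cases h : (t : ℝ) ≤ l (inner x)
      · exact Or.inl ⟨h, x, rfl, if_pos h⟩
      · exact Or.inr (if_neg h)
    · exact Or.inr rfl
  have hQ0 : ∀ z, Q (bdry z, 0) = bdry z := by
    intro z
    simp only [Q, hlz, map]
    simp [hH0, hGj]
  have hF : Continuous F := by
    rw [continuous_iff_continuousAt]
    rintro ⟨x | z, t⟩
    · have hop : IsOpenEmbedding (Prod.map inner id : X × I → SwappedSpace f i j × I) :=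
        hemb.prodMap .id
      refine (hop.continuousAt_iff (x := (x, t))).1 (Continuous.continuousAt ?_)
      refine Continuous.if_le (f' := fun q : X × I => (inner (T q.1 q.2) : SwappedSpace f i j))
        (g' := fun q : X × I => Q (inner q.1, q.2)) (hemb.continuous.comp hT)
        (hQ.comp hop.continuous) (by fun_prop)
        (hl.comp (hemb.continuous.comp continuous_fst)) ?_
      rintro ⟨x, t⟩ (h : (t : ℝ) = l (inner x))
      simp [Q, T, h, div_self (hlx x).ne', hH0, map, hGi, hK1]
    · by_cases ht : t = 0
      · subst ht
        rw [ContinuousAt, show F (bdry z, 0) = bdry z from hQ0 z, tendsto_def]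
        intro N hN
        -- This is the only delicate point: near `(z, 0)` both phases occur. `Q` is continuous
        -- there, and the `K` phase moves points by at most `E`, which is negligible near `z`.
        have h1 : Q ⁻¹' N ∈ 𝓝 ((bdry z, 0) : SwappedSpace f i j × I) :=
          hQ.continuousAt (by rwa [hQ0])
        filter_upwards [h1, continuousAt_fst.eventually (eventually_near hY hfu E z hN)]
          with q h1 h2
        rw [mem_preimage]
        obtain ⟨-, x, hx, h⟩ | h := hFor q
        · rw [h]
          refine h2 x hx _ ?_
          rw [dist_comm]
          exact hE (x, _)
        · rwa [h]
      · have ht' : l (bdry z : SwappedSpace f i j) < (t : ℝ) := by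
          rw [hlz]
          exact lt_of_le_of_ne t.2.1 fun h => ht (Subtype.ext h.symm)
        refine (hQ.continuousAt (x := (bdry z, t))).congr ?_
        have : ∀ᶠ q : SwappedSpace f i j × I in 𝓝 (bdry z, t), l q.1 < (q.2 : ℝ) :=
          (isOpen_lt (by fun_prop) (by fun_prop)).mem_nhds ht'
        filter_upwards [this] with q hq
        obtain ⟨h, -⟩ | h := hFor q
        · exact absurd h (not_le.2 hq)
        · exact h.symm
  refine ⟨⟨F, hF⟩, ?_, ?_⟩
  · rintro (x | z)
    · have h : F (inner x, 0) = inner (T x 0) := if_pos (hlx x).le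
      exact h.trans (by simp [T, hK0])
    · exact hQ0 z
  · rintro p t ht
    rw [range_bdry_eq, notMem_compl_iff]
    change F (p, t) ∈ _
    -- The first phase stays in `X`, and a boundary point has none for `t > 0`. In the second the
    -- clock of `H` is positive, so `H` lands in `Y`, which `G` sends into `X`.
    by_cases h' : (t : ℝ) ≤ l p
    · rcases p with x | z
      · exact ⟨T x t, (if_pos h').symm⟩
      · rw [hlz] at h'
        exact absurd h' (not_le.2 ht)
    · obtain ⟨h, -⟩ | h := hFor (p, t)
      · exact absurd h h'
      · have hpos : (0 : I) < projIcc 0 1 zero_le_one ((t : ℝ) - l p) := by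
          rw [← Subtype.coe_lt_coe, coe_projIcc]
          simp only [Icc.coe_zero]
          refine lt_max_of_lt_right (lt_min one_pos (by linarith))
        have h1 := hH (map p) _ hpos
        rw [hY.range_boundary, notMem_compl_iff] at h1
        obtain ⟨y, hy⟩ := h1
        refine ⟨g y, ?_⟩
        rw [h, ← hGi, hy]

theorem isControlledZCompactification [Nonempty X] (hY : IsControlledZCompactification i j)
    (hf : Continuous f) (hfc : IsCoarse f) {g : Y → X} (hg : Continuous g)
    (hgp : MetricallyProper g) (hfg : BoundedlyClose (f ∘ g) id)
    (hK : ∃ K : X × I → X, Continuous K ∧ (∀ x, K (x, 0) = x) ∧ (∀ x, K (x, 1) = g (f x)) ∧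
      BoundedlyClose K Prod.fst) :
    IsControlledZCompactification (inner : X → SwappedSpace f i j) bdry := by
  obtain ⟨G, hG, hGi, hGj⟩ := exists_extension_inverse hY hf hg hgp hfg
  obtain ⟨K, hK, hK0, hK1, hKc⟩ := hK
  have := hY.compact
  have := hY.hausdorff
  have hcl := isClosedEmbedding hY.toIsZCompactification hf hfc.1
  refine IsZCompactification.isControlled (Y := X) ⟨hcl.compactSpace, hcl.isEmbedding.t2Space,
    (isOpenEmbedding_inner hf hY.isEmbedding.continuous).isEmbedding, ?_,
    isEmbedding_bdry hY.isEmbedding_boundary, range_bdry_eq,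
    isZSet_bdry hY hf hfc.2 hG hGi hGj hK hK0 hK1 hKc⟩
    fun R z N hN => eventually_near hY hfc.2 R z hN
  rintro (x | z)
  · exact subset_closure ⟨x, rfl⟩
  -- Density transfers through `G`: `Y` accumulates at `j z`, and `G` maps `Y` into `X`.
  · rw [← hGj]
    refine closure_mono ?_ (image_closure_subset_closure_image hG ⟨j z, hY.denseRange (j z), rfl⟩)
    rintro _ ⟨_, ⟨y, rfl⟩, rfl⟩
    exact ⟨g y, (hGi y).symm⟩

end SwappedSpace

/-! ### Stability of coarse notions under bounded perturbation -/

theorem LargeScaleUniform.of_boundedlyClose {X Y : Type*} [MetricSpace X] [MetricSpace Y]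
    {f f' : X → Y} (hf : LargeScaleUniform f) (h : BoundedlyClose f' f) : LargeScaleUniform f' := by
  obtain ⟨K, hK⟩ := h
  intro R hR
  obtain ⟨S, hS, hf⟩ := hf R hR
  refine ⟨S + 2 * |K|, by positivity, fun x x' hx => ?_⟩
  have h1 := hf x x' hx
  have h2 := hK x
  have h3 := hK x'
  rw [dist_comm] at h3
  have h4 := dist_triangle4 (f' x) (f x) (f x') (f' x')
  linarith [le_abs_self K]

theorem MetricallyProper.of_boundedlyClose {X Y : Type*} [MetricSpace X] [MetricSpace Y]
    {f f' : X → Y} (hf : MetricallyProper f) (h : BoundedlyClose f' f) : MetricallyProper f' := by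
  obtain ⟨K, hK⟩ := h
  intro B hB
  refine (hf _ (hB.cthickening (δ := K))).subset fun x hx => ?_
  exact Metric.mem_cthickening_of_dist_le _ (f' x) _ B hx (by rw [dist_comm]; exact hK x)

theorem IsCoarse.of_boundedlyClose {X Y : Type*} [MetricSpace X] [MetricSpace Y]
    {f f' : X → Y} (hf : IsCoarse f) (h : BoundedlyClose f' f) : IsCoarse f' :=
  ⟨hf.1.of_boundedlyClose h, hf.2.of_boundedlyClose h⟩

/-- Composites of boundedly close maps remain boundedly close to the identity. -/
theorem BoundedlyClose.comp_id {X Y : Type*} [MetricSpace X] [MetricSpace Y] {f f' : X → Y}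
    {g g' : Y → X} (hg : LargeScaleUniform g) (hf' : BoundedlyClose f' f)
    (hg' : BoundedlyClose g' g) (h : BoundedlyClose (g ∘ f) id) :
    BoundedlyClose (g' ∘ f') id := by
  obtain ⟨a, ha⟩ := hf'
  obtain ⟨b, hb⟩ := hg'
  obtain ⟨c, hc⟩ := h
  obtain ⟨S, hS⟩ := hg.exists_dist_le a
  refine ⟨b + S + c, fun x => ?_⟩
  exact (dist_triangle4 _ (g (f' x)) (g (f x)) _).trans
    (add_le_add (add_le_add (hb _) (hS _ _ (ha x))) (hc x))

theorem BoundedlyClose.refl {X Y : Type*} [MetricSpace Y] [MetricSpace X] (f : X → Y) :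
    BoundedlyClose f f := ⟨0, fun x => by simp⟩

end BoundarySwapping

/-! ### The boundary swapping theorem -/

theorem theorem7p1 {X : Type u} {Y : Type v} {Z : Type w} {Ybar : Type w'}
    [MetricSpace X] [ProperSpace X] [MetricSpace Y] [ProperSpace Y]
    [TopologicalSpace Z] [TopologicalSpace Ybar]
    (hX : BoundarySwapping.UniformlyContractible X)
    (hY : BoundarySwapping.UniformlyContractible Y)
    (hX' : BoundarySwapping.FiniteMacroscopicDimension X)
    (hY' : BoundarySwapping.FiniteMacroscopicDimension Y)
    (f : X → Y) (hf : BoundarySwapping.IsCoarseEquivalence f)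
    (iY : Y → Ybar) (jY : Z → Ybar)
    (hYbar : BoundarySwapping.IsControlledZCompactification iY jY) :
    ∃ (Xbar : Type (max u w)) (_ : TopologicalSpace Xbar) (iX : X → Xbar) (jX : Z → Xbar),
      BoundarySwapping.IsControlledZCompactification iX jX ∧
      (Continuous f → ∃ fbar : Xbar → Ybar, Continuous fbar ∧
        (∀ x, fbar (iX x) = iY (f x)) ∧ ∀ z, fbar (jX z) = jY z) := by
  open BoundarySwapping in
  obtain ⟨hfc, g, hgc, hgf, hfg⟩ := hf
  -- A continuous `f` is kept unchanged, so that the canonical map on the new space extends `f`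
  -- itself.
  obtain ⟨f', hf', hff', hext⟩ : ∃ f' : X → Y, Continuous f' ∧ BoundedlyClose f' f ∧
      (Continuous f → f' = f) := by
    by_cases h : Continuous f
    · exact ⟨f, h, .refl f, fun _ => rfl⟩
    · obtain ⟨f', h1, h2⟩ := hfc.2.exists_continuous hX' hY
      exact ⟨f', h1, h2, fun h' => absurd h' h⟩
  obtain ⟨g', hg', hgg'⟩ := hgc.2.exists_continuous hY' hX
  -- If `Y` were empty, density would make `Ybar` empty; the empty family would then be a cover, and
  -- control would yield a member of it.
  have hY₀ : Nonempty Y := by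
    by_contra hne
    rw [not_nonempty_iff] at hne
    have hW : IsEmpty Ybar := ⟨fun a => by
      obtain ⟨y⟩ := (hYbar.denseRange.nonempty_iff).2 ⟨a⟩
      exact hne.false y⟩
    obtain ⟨C, -, hC⟩ := hYbar.control 1 one_pos ∅ (by simp) (Subsingleton.elim _ _)
    obtain ⟨U, hU, -⟩ := hC ∅ (by simp) (by simp) (by simp)
    exact hU
  have hX₀ : Nonempty X := hY₀.map g
  refine ⟨SwappedSpace f' iY jY, inferInstance, .inner, .bdry,
    SwappedSpace.isControlledZCompactification hYbar hf' (hfc.of_boundedlyClose hff') hg'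
      (hgc.of_boundedlyClose hgg').1 (.comp_id hfc.2 hgg' hff' hfg)
      (BoundedlyClose.exists_homotopy hX' hX (hg'.comp hf') (.comp_id hgc.2 hff' hgg' hgf)),
    fun h => ⟨SwappedSpace.map, SwappedSpace.continuous_map, fun x => ?_, fun z => rfl⟩⟩
  rw [← hext h]
  rfl
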